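/- Let $K$ be an arbitrary field, let $V$ be a finite-dimensional vector space over $K$, and let $\mathrm{Symm}(V)$ be the $K$-vector space of symmetric bilinear forms $V\times V\to K$. Let $M$ be a nonzero $K$-subspace of $\mathrm{Symm}(V)$. Suppose that the rank of each nonzero element of $M$ is odd, and let $r$ be the maximum rank of the elements of $M$. Then $$\dim_K M\le \frac{r(r+1)}{2}.$$ -/

import Mathlib

/-- `Symm(V)`: the vector space of symmetric bilinear forms on `V × V`. -/
def symmForms (K V : Type*) [Field K] [AddCommGroup V] [Module K V] :
    Submodule K (LinearMap.BilinForm K V) where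
  carrier := {f | f.IsSymm}
  add_mem' hf hg := hf.add hg
  zero_mem' := LinearMap.BilinForm.isSymm_zero
  smul_mem' c _ hf := hf.smul c

/-- The rank of a bilinear form `f` on a finite-dimensional space `V`: the dimension of the image
of the linear map `V → V*`, `u ↦ f u`; equivalently the rank of any Gram matrix of `f`. -/
noncomputable def bilinRank {K V : Type*} [Field K] [AddCommGroup V] [Module K V]
    (f : LinearMap.BilinForm K V) : ℕ :=
  Module.finrank K (LinearMap.range f)

/-! Take `f` in `M` of maximal rank `r` and a complement `W` of its radical, so `dim W = r`. If `g`
in `M` vanishes on `W`, maximality gives rank `(f + g)` ≤ rank `f`, and `even_bilinRank_of_add_le`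
makes the rank of `g` even, so `g = 0`. Restriction to `W` is thus injective on `M`. -/

open Module in
theorem finrank_symm_le_of_restrict_eq_zero {K V : Type*} [Field K] [AddCommGroup V] [Module K V]
    [FiniteDimensional K V] (M : Submodule K (LinearMap.BilinForm K V)) (hM : M ≤ symmForms K V)
    (W : Submodule K V)
    (hW : ∀ g ∈ M, (∀ x ∈ W, ∀ y ∈ W, g x y = 0) → g = 0) :
    finrank K M ≤ finrank K W * (finrank K W + 1) / 2 := by
  let b := finBasis K W
  -- Gram entries at unordered pairs; by symmetry the ordering picked by `out` loses nothing.
  let Φ : M →ₗ[K] (Sym2 (Fin (finrank K W)) → K) :=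
    { toFun := fun g s => g.1 (b s.out.1) (b s.out.2)
      map_add' := fun _ _ => rfl
      map_smul' := fun _ _ => rfl }
  have hΦ : Function.Injective Φ := by
    rintro ⟨g₁, hg₁⟩ ⟨g₂, hg₂⟩ h12
    obtain ⟨g, rfl⟩ : ∃ g, g₁ = g + g₂ := ⟨g₁ - g₂, (sub_add_cancel g₁ g₂).symm⟩
    have hg : g ∈ M := by
      have h := M.add_mem hg₁ (M.smul_mem (-1 : K) hg₂)
      have hneg : g + g₂ + (-1 : K) • g₂ = g :=
        LinearMap.ext₂ fun x y => show g x y + g₂ x y + (-1 : K) * g₂ x y = g x y by ring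
      rwa [← hneg]
    have hb : ∀ i j, g (b i) (b j) = 0 := by
      intro i j
      have h : g (b s(i, j).out.1) (b s(i, j).out.2) = 0 := add_eq_right.mp (congrFun h12 s(i, j))
      have hs : s(s(i, j).out.1, s(i, j).out.2) = s(i, j) := Quot.out_eq _
      rcases Sym2.eq_iff.mp hs with ⟨h1, h2⟩ | ⟨h1, h2⟩
      · rwa [h1, h2] at h
      · rw [h1, h2] at h
        exact ((hM hg).eq (b j) (b i)).symm.trans h
    have hres : g.restrict W = 0 := LinearMap.BilinForm.ext_basis b fun i j => hb i j
    have hg0 : g = 0 := hW g hg fun x hx y hy =>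
      LinearMap.congr_fun₂ hres (⟨x, hx⟩ : W) (⟨y, hy⟩ : W)
    exact Subtype.ext ((congrArg (· + g₂) hg0).trans (zero_add g₂))
  refine (LinearMap.finrank_le_finrank_of_injective hΦ).trans ?_
  rw [finrank_fintype_fun_eq_card, Sym2.card, Fintype.card_fin, Nat.choose_two_right,
    Nat.add_sub_cancel, mul_comm]

-- Counting dimensions gives rank `2 * (dim W - dim (W ⊓ ker g))`.
open Module in
theorem even_bilinRank_of_orthogonal_eq_sup {K V : Type*} [Field K] [AddCommGroup V] [Module K V]
    [FiniteDimensional K V] {g : LinearMap.BilinForm K V} {W : Submodule K V}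
    (h : g.orthogonal W = W ⊔ LinearMap.ker g) : Even (bilinRank g) := by
  have h1 := LinearMap.BilinForm.finrank_add_finrank_orthogonal' (B := g) W
  have h2 := Submodule.finrank_sup_add_finrank_inf_eq W (LinearMap.ker g)
  have h3 := LinearMap.finrank_range_add_finrank_ker g
  rw [h] at h1
  rw [Nat.even_iff, bilinRank]
  omega

open Module in
/-- If adding `g` does not increase the rank of `f`, and some complement `W` of the radical of `f`
is totally isotropic for `g`, then the rank of `g` is even. -/
theorem even_bilinRank_of_add_le {K V : Type*} [Field K] [AddCommGroup V] [Module K V]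
    [FiniteDimensional K V] {f g : LinearMap.BilinForm K V} (hf : f.IsSymm) (hg : g.IsSymm)
    {W : Submodule K V} (hW : IsCompl W (LinearMap.ker f))
    (hle : bilinRank (f + g) ≤ bilinRank f) (h0 : ∀ x ∈ W, ∀ y ∈ W, g x y = 0) :
    Even (bilinRank g) := by
  have hadd : ∀ x y, (f + g) x y = f x y + g x y := fun _ _ => rfl
  have hker : ∀ x ∈ LinearMap.ker f, ∀ y, f x y = 0 := fun x hx y => by
    rw [LinearMap.mem_ker.mp hx]; rfl
  have hker' : ∀ x ∈ LinearMap.ker f, ∀ y, f y x = 0 := fun x hx y =>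
    (hf.eq x y).symm.trans (hker x hx y)
  -- On `W`, `f + g` agrees with `f`, which is nondegenerate there.
  have hdisj : Disjoint W (LinearMap.ker (f + g)) := by
    rw [Submodule.disjoint_def]
    intro x hxW hx
    refine (Submodule.disjoint_def.mp hW.disjoint) x hxW (LinearMap.ext fun y => ?_)
    obtain ⟨w, hw, z, hz, rfl⟩ :=
      Submodule.mem_sup.mp (hW.sup_eq_top ▸ Submodule.mem_top : y ∈ W ⊔ LinearMap.ker f)
    have h1 : (f + g) x w = 0 := by rw [LinearMap.mem_ker.mp hx]; rfl
    rw [hadd, h0 x hxW w hw, add_zero] at h1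
    rw [map_add, h1, hker' z hz, add_zero]; rfl
  have hsup : W ⊔ LinearMap.ker (f + g) = ⊤ := by
    refine Submodule.eq_top_of_disjoint _ _ ?_ hdisj
    have h1 := LinearMap.finrank_range_add_finrank_ker f
    have h2 := LinearMap.finrank_range_add_finrank_ker (f + g)
    have h3 := Submodule.finrank_add_eq_of_isCompl hW
    rw [bilinRank, bilinRank] at hle
    omega
  refine even_bilinRank_of_orthogonal_eq_sup (W := W) (le_antisymm ?_ ?_)
  · intro x hx
    obtain ⟨w, hw, z, hz, rfl⟩ :=
      Submodule.mem_sup.mp (hW.sup_eq_top ▸ Submodule.mem_top : x ∈ W ⊔ LinearMap.ker f)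
    -- `z` lies in `ker g`: it is `g`-orthogonal to `W` because `w + z` and `w` are, and to `ker (f
    -- + g)` because `f` kills `z`.
    refine Submodule.add_mem_sup hw (LinearMap.ext fun y => ?_)
    obtain ⟨w', hw', k, hk, rfl⟩ :=
      Submodule.mem_sup.mp (hsup ▸ Submodule.mem_top : y ∈ W ⊔ LinearMap.ker (f + g))
    have h1 : g w' (w + z) = 0 := LinearMap.BilinForm.mem_orthogonal_iff.mp hx w' hw'
    rw [map_add, h0 w' hw' w hw, zero_add] at h1
    have h2 : (f + g) k z = 0 := by rw [LinearMap.mem_ker.mp hk]; rfl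
    rw [hadd, hker' z hz, zero_add] at h2
    have h3 : g z w' = 0 := (hg.eq w' z).symm.trans h1
    have h4 : g z k = 0 := (hg.eq k z).symm.trans h2
    rw [map_add, h3, h4, add_zero]; rfl
  · refine sup_le (fun x hx => ?_) (fun x hx => ?_) <;>
      refine LinearMap.BilinForm.mem_orthogonal_iff.mpr fun y hy => ?_
    · exact h0 y hy x hx
    · refine (hg.eq x y).symm.trans ?_
      rw [LinearMap.mem_ker.mp hx]; rfl

theorem corollary1 {K V : Type*} [Field K] [AddCommGroup V] [Module K V] [FiniteDimensional K V]
    (M : Submodule K (LinearMap.BilinForm K V)) (hM : M ≤ symmForms K V) (hM0 : M ≠ ⊥)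
    (hodd : ∀ f ∈ M, f ≠ 0 → Odd (bilinRank f))
    (r : ℕ) (hr : IsGreatest {k : ℕ | ∃ f ∈ M, bilinRank f = k} r) :
    Module.finrank K M ≤ r * (r + 1) / 2 := by
  obtain ⟨⟨f, hf, rfl⟩, hmax⟩ := hr
  obtain ⟨W, hW⟩ := Submodule.exists_isCompl (LinearMap.ker f)
  have hWr : Module.finrank K W = bilinRank f := by
    have h1 := LinearMap.finrank_range_add_finrank_ker f
    have h2 := Submodule.finrank_add_eq_of_isCompl hW
    rw [bilinRank]
    omega
  rw [← hWr]
  refine finrank_symm_le_of_restrict_eq_zero M hM W fun g hg h0 => ?_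
  by_contra hne
  exact Nat.not_even_iff_odd.mpr (hodd g hg hne) (even_bilinRank_of_add_le (hM hf) (hM hg) hW.symm
    (hmax ⟨f + g, M.add_mem hf hg, rfl⟩) h0)
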